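/- All Lie algebras are over $\mathbb C$. Let $\mathfrak g_0$ be a finite-dimensional reductive Lie algebra, let $B_0$ be a nondegenerate invariant symmetric bilinear form on $\mathfrak g_0$, and let $(\rho,V)$ be a finite-dimensional completely reducible representation of $\mathfrak g_0$. Let $\Gamma(\mathfrak g_0,B_0,\rho)=V^*\oplus\mathfrak g_0\oplus V$ (degrees $-1,0,1$) be the local Lie algebra with the bracket of $\mathfrak g_0$ in degree $0$, with $[U,X]=\rho(U)X$ and $[U,Y]=\rho^*(U)Y$ for $U\in\mathfrak g_0$, $X\in V$, $Y\in V^*$, where $\rho^*$ is the contragredient representation, and with $[X,Y]=-[Y,X]\in\mathfrak g_0$ defined by $B_0([X,Y],U)=Y(\rho(U)X)$ for all $U\in\mathfrak g_0$. Let $\mathfrak g_{max}(\Gamma(\mathfrak g_0,B_0,\rho))$ be the maximal graded Lie algebra with local part $\Gamma(\mathfrak g_0,B_0,\rho)$, that is, the $\mathbb Z$-graded Lie algebra generated by $\Gamma(\mathfrak g_0,B_0,\rho)$ subject to all relations holding in it, and let the minimal graded Lie algebra $\mathfrak g_{min}(\Gamma(\mathfrak g_0,B_0,\rho))$ be its quotient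 by the largest graded ideal that meets $\Gamma(\mathfrak g_0,B_0,\rho)$ only in $0$. Suppose that $\Gamma(\mathfrak g_0,B_0,\rho)=\mathfrak g_{-1}\oplus\mathfrak g_0\oplus\mathfrak g_1$ is transitive: for $x\in\mathfrak g_0\cup\mathfrak g_1$, $[x,\mathfrak g_{-1}]=0$ implies $x=0$, and for $x\in\mathfrak g_0\cup\mathfrak g_{-1}$, $[x,\mathfrak g_1]=0$ implies $x=0$. If $\mathfrak g_{min}(\Gamma(\mathfrak g_0,B_0,\rho))$ is finite-dimensional, then it is a semisimple Lie algebra. -/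

import Mathlib

/-- The structure of a (complex) local Lie algebra on the direct sum
`gm ⊕ g₀ ⊕ gp` of its parts of degree `-1`, `0`, `1`. The brackets of degrees `(0, 0)`, `(0, ±1)`,
with the Jacobi identities that involve only them, are the statement that `g₀` is a Lie algebra and
that `gm`, `gp` are `g₀`-modules. What remains is the bracket `[x, y]` of `x` in degree `1` with `y`
in degree `-1`, and the Jacobi identity in degrees `(0, 1, -1)`. The brackets in the opposite order
are given by anticommutativity; there is no bracket in degrees `(1, 1)` and `(-1, -1)`. -/
structure LocalLieAlgebra (gm g₀ gp : Type*) [LieRing g₀] [LieAlgebra ℂ g₀]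
    [AddCommGroup gm] [Module ℂ gm] [LieRingModule g₀ gm] [LieModule ℂ g₀ gm]
    [AddCommGroup gp] [Module ℂ gp] [LieRingModule g₀ gp] [LieModule ℂ g₀ gp] where
  /-- The bracket `[x, y]` for `x` of degree `1` and `y` of degree `-1`. -/
  pairing : gp →ₗ[ℂ] gm →ₗ[ℂ] g₀
  /-- The Jacobi identity `[u, [x, y]] = [[u, x], y] + [x, [u, y]]`. -/
  lie_pairing : ∀ (u : g₀) (x : gp) (y : gm),
    ⁅u, pairing x y⁆ = pairing ⁅u, x⁆ y + pairing x ⁅u, y⁆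

namespace LocalLieAlgebra

variable {gm g₀ gp : Type*} [LieRing g₀] [LieAlgebra ℂ g₀]
  [AddCommGroup gm] [Module ℂ gm] [LieRingModule g₀ gm] [LieModule ℂ g₀ gm]
  [AddCommGroup gp] [Module ℂ gp] [LieRingModule g₀ gp] [LieModule ℂ g₀ gp]

/-- Transitivity: an element of degree `0` or `1` that commutes with the part of degree `-1` is
zero, and an element of degree `0` or `-1` that commutes with the part of degree `1` is zero. -/
structure IsTransitive (Γ : LocalLieAlgebra gm g₀ gp) : Prop where
  zero_neg : ∀ u : g₀, (∀ y : gm, ⁅u, y⁆ = 0) → u = 0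
  pos_neg : ∀ x : gp, (∀ y : gm, Γ.pairing x y = 0) → x = 0
  zero_pos : ∀ u : g₀, (∀ x : gp, ⁅u, x⁆ = 0) → u = 0
  neg_pos : ∀ y : gm, (∀ x : gp, Γ.pairing x y = 0) → y = 0

/-- The free Lie algebra on the disjoint union of the sets underlying `gm`, `g₀`, `gp`. -/
abbrev FreeOn (_Γ : LocalLieAlgebra gm g₀ gp) : Type _ := FreeLieAlgebra ℂ (gm ⊕ g₀ ⊕ gp)

/-- The generator attached to an element of degree `-1`. -/
noncomputable def freeNeg (Γ : LocalLieAlgebra gm g₀ gp) (y : gm) : Γ.FreeOn :=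
  FreeLieAlgebra.of ℂ (Sum.inl y)

/-- The generator attached to an element of degree `0`. -/
noncomputable def freeZero (Γ : LocalLieAlgebra gm g₀ gp) (u : g₀) : Γ.FreeOn :=
  FreeLieAlgebra.of ℂ (Sum.inr (Sum.inl u))

/-- The generator attached to an element of degree `1`. -/
noncomputable def freePos (Γ : LocalLieAlgebra gm g₀ gp) (x : gp) : Γ.FreeOn :=
  FreeLieAlgebra.of ℂ (Sum.inr (Sum.inr x))

/-- The defining relations (as elements to be set to zero) of the maximal graded Lie algebra: the
linear relations in each degree and the brackets of the local Lie algebra. -/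
inductive IsRelator (Γ : LocalLieAlgebra gm g₀ gp) : Γ.FreeOn → Prop
  | add_neg (y y' : gm) : IsRelator Γ (Γ.freeNeg (y + y') - (Γ.freeNeg y + Γ.freeNeg y'))
  | smul_neg (c : ℂ) (y : gm) : IsRelator Γ (Γ.freeNeg (c • y) - c • Γ.freeNeg y)
  | add_zero (u u' : g₀) : IsRelator Γ (Γ.freeZero (u + u') - (Γ.freeZero u + Γ.freeZero u'))
  | smul_zero (c : ℂ) (u : g₀) : IsRelator Γ (Γ.freeZero (c • u) - c • Γ.freeZero u)
  | add_pos (x x' : gp) : IsRelator Γ (Γ.freePos (x + x') - (Γ.freePos x + Γ.freePos x'))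
  | smul_pos (c : ℂ) (x : gp) : IsRelator Γ (Γ.freePos (c • x) - c • Γ.freePos x)
  | lie_zero_zero (u u' : g₀) :
      IsRelator Γ (⁅Γ.freeZero u, Γ.freeZero u'⁆ - Γ.freeZero ⁅u, u'⁆)
  | lie_zero_pos (u : g₀) (x : gp) :
      IsRelator Γ (⁅Γ.freeZero u, Γ.freePos x⁆ - Γ.freePos ⁅u, x⁆)
  | lie_zero_neg (u : g₀) (y : gm) :
      IsRelator Γ (⁅Γ.freeZero u, Γ.freeNeg y⁆ - Γ.freeNeg ⁅u, y⁆)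
  | lie_pos_neg (x : gp) (y : gm) :
      IsRelator Γ (⁅Γ.freePos x, Γ.freeNeg y⁆ - Γ.freeZero (Γ.pairing x y))

/-- The ideal generated by the defining relations. -/
noncomputable def relationIdeal (Γ : LocalLieAlgebra gm g₀ gp) : LieIdeal ℂ Γ.FreeOn :=
  LieSubmodule.lieSpan ℂ Γ.FreeOn {r | Γ.IsRelator r}

/-- The maximal graded Lie algebra with local part `Γ`: the Lie algebra generated by `Γ`, subject
to all the relations that hold in `Γ`. Lie homomorphisms from it are the same as maps from `Γ` that
are linear and respect the brackets of `Γ`. -/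
abbrev gMax (Γ : LocalLieAlgebra gm g₀ gp) : Type _ := Γ.FreeOn ⧸ Γ.relationIdeal

/-- The canonical map to the maximal graded Lie algebra from the part of degree `-1`. -/
noncomputable def maxNeg (Γ : LocalLieAlgebra gm g₀ gp) (y : gm) : Γ.gMax :=
  LieSubmodule.Quotient.mk (Γ.freeNeg y)

/-- The canonical map to the maximal graded Lie algebra from the part of degree `0`. -/
noncomputable def maxZero (Γ : LocalLieAlgebra gm g₀ gp) (u : g₀) : Γ.gMax :=
  LieSubmodule.Quotient.mk (Γ.freeZero u)

/-- The canonical map to the maximal graded Lie algebra from the part of degree `1`. -/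
noncomputable def maxPos (Γ : LocalLieAlgebra gm g₀ gp) (x : gp) : Γ.gMax :=
  LieSubmodule.Quotient.mk (Γ.freePos x)

/-- Iterated brackets of elements of the local part, with their degree. -/
inductive IsMonomial (Γ : LocalLieAlgebra gm g₀ gp) : ℤ → Γ.gMax → Prop
  | neg (y : gm) : IsMonomial Γ (-1) (Γ.maxNeg y)
  | zero (u : g₀) : IsMonomial Γ 0 (Γ.maxZero u)
  | pos (x : gp) : IsMonomial Γ 1 (Γ.maxPos x)
  | lie {m n : ℤ} {a b : Γ.gMax} :
      IsMonomial Γ m a → IsMonomial Γ n b → IsMonomial Γ (m + n) ⁅a, b⁆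

/-- The homogeneous part of degree `n` of the maximal graded Lie algebra. -/
noncomputable def gMaxDegree (Γ : LocalLieAlgebra gm g₀ gp) (n : ℤ) : Submodule ℂ Γ.gMax :=
  Submodule.span ℂ {a | Γ.IsMonomial n a}

/-- The local part of the maximal graded Lie algebra: the image of `gm ⊕ g₀ ⊕ gp`. -/
noncomputable def gMaxLocalPart (Γ : LocalLieAlgebra gm g₀ gp) : Submodule ℂ Γ.gMax :=
  Submodule.span ℂ (Set.range Γ.maxNeg ∪ Set.range Γ.maxZero ∪ Set.range Γ.maxPos)

/-- An ideal of the maximal graded Lie algebra is graded if it is the sum of its intersections with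
the homogeneous parts. -/
def IsGradedIdeal (Γ : LocalLieAlgebra gm g₀ gp) (J : LieIdeal ℂ Γ.gMax) : Prop :=
  J.toSubmodule = ⨆ n : ℤ, J.toSubmodule ⊓ Γ.gMaxDegree n

/-- The largest graded ideal that meets the local part trivially, as the sum of all such ideals. -/
noncomputable def maximalIdeal (Γ : LocalLieAlgebra gm g₀ gp) : LieIdeal ℂ Γ.gMax :=
  sSup {J : LieIdeal ℂ Γ.gMax |
    Γ.IsGradedIdeal J ∧ Disjoint J.toSubmodule Γ.gMaxLocalPart}

/-- The minimal graded Lie algebra with local part `Γ`: the quotient of the maximal one by the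
largest graded ideal that meets the local part trivially. -/
abbrev gMin (Γ : LocalLieAlgebra gm g₀ gp) : Type _ := Γ.gMax ⧸ Γ.maximalIdeal

end LocalLieAlgebra

/-- A nondegenerate invariant symmetric bilinear form on a Lie algebra, which makes it a quadratic
Lie algebra when it is finite-dimensional. -/
structure QuadraticLieForm (g₀ : Type*) [LieRing g₀] [LieAlgebra ℂ g₀] where
  /-- The bilinear form. -/
  form : LinearMap.BilinForm ℂ g₀
  nondegenerate : form.Nondegenerate
  symm : ∀ u v : g₀, form u v = form v u
  invariant : ∀ u v w : g₀, form ⁅u, v⁆ w = form u ⁅v, w⁆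

namespace QuadraticLieForm

variable {g₀ : Type*} [LieRing g₀] [LieAlgebra ℂ g₀] [FiniteDimensional ℂ g₀]

/-- For `x` in `V` and `y` in the dual of `V`, the unique element `[x, y]` of `g₀` such that
`B₀ ([x, y], u) = y (u.x)` for all `u` in `g₀`. -/
noncomputable def pairing (B₀ : QuadraticLieForm g₀) (V : Type*) [AddCommGroup V] [Module ℂ V]
    [LieRingModule g₀ V] [LieModule ℂ g₀ V] :
    V →ₗ[ℂ] Module.Dual ℂ V →ₗ[ℂ] g₀ :=
  LinearMap.mk₂ ℂ
    (fun x y => (B₀.form.toDual B₀.nondegenerate).symm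
      (y ∘ₗ ((LieModule.toEnd ℂ g₀ V : g₀ →ₗ[ℂ] Module.End ℂ V).flip x)))
    (fun x x' y => by rw [← map_add, map_add, LinearMap.comp_add])
    (fun c x y => by rw [← map_smul, map_smul, LinearMap.comp_smul])
    (fun x y y' => by rw [← map_add, LinearMap.add_comp])
    (fun c x y => by rw [← map_smul, LinearMap.smul_comp])

/-- The characteristic property of the bracket between `V` and its dual. -/
theorem form_pairing (B₀ : QuadraticLieForm g₀) (V : Type*) [AddCommGroup V] [Module ℂ V]
    [LieRingModule g₀ V] [LieModule ℂ g₀ V] (x : V) (y : Module.Dual ℂ V) (u : g₀) :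
    B₀.form (B₀.pairing V x y) u = y ⁅u, x⁆ := by
  simp [pairing, LinearMap.BilinForm.apply_toDual_symm_apply]

/-- The local Lie algebra `V* ⊕ g₀ ⊕ V` attached to a fundamental triplet, that is to a quadratic
Lie algebra `(g₀, B₀)` with a representation on `V`. The action of `g₀` on the dual `V*` is the
contragredient one. -/
noncomputable def localLieAlgebra (B₀ : QuadraticLieForm g₀) (V : Type*) [AddCommGroup V]
    [Module ℂ V] [LieRingModule g₀ V] [LieModule ℂ g₀ V] :
    LocalLieAlgebra (Module.Dual ℂ V) g₀ V where
  pairing := B₀.pairing V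
  lie_pairing u x y := by
    apply (B₀.form.toDual B₀.nondegenerate).injective
    ext w
    have h1 : B₀.form ⁅u, B₀.pairing V x y⁆ w = - B₀.form (B₀.pairing V x y) ⁅u, w⁆ := by
      rw [← lie_skew, map_neg, LinearMap.neg_apply, B₀.invariant]
    simp only [LinearMap.BilinForm.toDual_def, map_add, LinearMap.add_apply, h1, form_pairing,
      Module.Dual.lie_apply, lie_lie, map_sub]
    ring

end QuadraticLieForm

/-! Semisimplicity amounts to the vanishing of the radical. If the radical were nonzero, the last
nonzero term of its derived series would be a nonzero abelian ideal. Being canonical, that ideal is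
stable under every automorphism, in particular under the scalings by `t ^ n` in degree `n`, and is
therefore graded. So it suffices that a graded abelian ideal `A` is zero. This is done for any
transitive local Lie algebra whose degree-zero part is reductive and acts completely reducibly in
degree `1`.

The degree-zero part of `A` is an abelian ideal of `g₀`, hence central by reductivity. For `u` in it
and `x` in degree `1`, both `u` and `[u, x]` lie in `A`, so `[u, [u, x]] = 0`. A central operator of
square zero on a completely reducible module is zero, so `u` acts trivially and `u = 0` by
transitivity. An element of `A` of degree `1` or `-1` brackets the opposite degree into the
degree-zero part of `A`, which is `0`, and vanishes by transitivity again. Thus the preimage of `A`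
in the maximal algebra meets the local part trivially, lies in the maximal ideal, and `A = 0`.

Since the algebras are given by generators and relations, three facts need proof: degrees `0` and
`1` of a transitive `Γ` embed in `gMax` (by a coinduced representation), degrees `-1, 0, 1` of
`gMax` contain nothing beyond the image of `Γ` (by left-normed brackets), and the sum defining
`maximalIdeal` still meets the local part trivially (by independence of the degrees). -/

namespace LocalLieAlgebra

/-! ### Universal property of the maximal graded Lie algebra. -/

section Lift

variable {gm g₀ gp : Type*} [LieRing g₀] [LieAlgebra ℂ g₀]
  [AddCommGroup gm] [Module ℂ gm] [LieRingModule g₀ gm] [LieModule ℂ g₀ gm]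
  [AddCommGroup gp] [Module ℂ gp] [LieRingModule g₀ gp] [LieModule ℂ g₀ gp]
  (Γ : LocalLieAlgebra gm g₀ gp)

/-- The projection from the free Lie algebra to the maximal graded Lie algebra. -/
noncomputable def maxMk : Γ.FreeOn →ₗ⁅ℂ⁆ Γ.gMax where
  toLinearMap := Γ.relationIdeal.toSubmodule.mkQ
  map_lie' := rfl

theorem maxMk_surjective : Function.Surjective Γ.maxMk := Quot.mk_surjective

theorem maxMk_eq_of_isRelator {a b : Γ.FreeOn} (h : Γ.IsRelator (a - b)) :
    Γ.maxMk a = Γ.maxMk b := by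
  rw [← sub_eq_zero, ← map_sub]
  exact (LieSubmodule.Quotient.mk_eq_zero' (N := Γ.relationIdeal)).2
    (LieSubmodule.subset_lieSpan h)

/-- `maxNeg` as a linear map. -/
noncomputable def maxNegₗ : gm →ₗ[ℂ] Γ.gMax where
  toFun := Γ.maxNeg
  map_add' y y' := (Γ.maxMk_eq_of_isRelator (.add_neg y y')).trans (map_add _ _ _)
  map_smul' c y := (Γ.maxMk_eq_of_isRelator (.smul_neg c y)).trans (map_smul _ _ _)

/-- `maxZero` as a linear map. -/
noncomputable def maxZeroₗ : g₀ →ₗ[ℂ] Γ.gMax where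
  toFun := Γ.maxZero
  map_add' y y' := (Γ.maxMk_eq_of_isRelator (.add_zero y y')).trans (map_add _ _ _)
  map_smul' c y := (Γ.maxMk_eq_of_isRelator (.smul_zero c y)).trans (map_smul _ _ _)

/-- `maxPos` as a linear map. -/
noncomputable def maxPosₗ : gp →ₗ[ℂ] Γ.gMax where
  toFun := Γ.maxPos
  map_add' y y' := (Γ.maxMk_eq_of_isRelator (.add_pos y y')).trans (map_add _ _ _)
  map_smul' c y := (Γ.maxMk_eq_of_isRelator (.smul_pos c y)).trans (map_smul _ _ _)

@[simp] theorem maxNegₗ_apply (y : gm) : Γ.maxNegₗ y = Γ.maxNeg y := rfl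

@[simp] theorem maxZeroₗ_apply (u : g₀) : Γ.maxZeroₗ u = Γ.maxZero u := rfl

@[simp] theorem maxPosₗ_apply (x : gp) : Γ.maxPosₗ x = Γ.maxPos x := rfl

theorem maxZero_lie_maxZero (u u' : g₀) : ⁅Γ.maxZero u, Γ.maxZero u'⁆ = Γ.maxZero ⁅u, u'⁆ :=
  Γ.maxMk_eq_of_isRelator (.lie_zero_zero u u')

theorem maxZero_lie_maxPos (u : g₀) (x : gp) : ⁅Γ.maxZero u, Γ.maxPos x⁆ = Γ.maxPos ⁅u, x⁆ :=
  Γ.maxMk_eq_of_isRelator (.lie_zero_pos u x)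

theorem maxZero_lie_maxNeg (u : g₀) (y : gm) : ⁅Γ.maxZero u, Γ.maxNeg y⁆ = Γ.maxNeg ⁅u, y⁆ :=
  Γ.maxMk_eq_of_isRelator (.lie_zero_neg u y)

theorem maxPos_lie_maxNeg (x : gp) (y : gm) :
    ⁅Γ.maxPos x, Γ.maxNeg y⁆ = Γ.maxZero (Γ.pairing x y) :=
  Γ.maxMk_eq_of_isRelator (.lie_pos_neg x y)

theorem maxNeg_lie_maxPos (x : gp) (y : gm) :
    ⁅Γ.maxNeg y, Γ.maxPos x⁆ = -Γ.maxZero (Γ.pairing x y) := by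
  rw [← maxPos_lie_maxNeg, lie_skew]

/-- A Lie subalgebra of the maximal graded Lie algebra that contains the local part is everything. -/
theorem mem_of_generators (S : LieSubalgebra ℂ Γ.gMax) (hn : ∀ y, Γ.maxNeg y ∈ S)
    (hz : ∀ u, Γ.maxZero u ∈ S) (hp : ∀ x, Γ.maxPos x ∈ S) (a : Γ.gMax) : a ∈ S := by
  obtain ⟨b, rfl⟩ := Γ.maxMk_surjective a
  -- The projection factors through `S`, because both maps out of the free Lie algebra agree on
  -- generators.
  let g : gm ⊕ g₀ ⊕ gp → S := Sum.elim (fun y => ⟨_, hn y⟩)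
    (Sum.elim (fun u => ⟨_, hz u⟩) (fun x => ⟨_, hp x⟩))
  have h : Γ.maxMk = S.incl.comp (FreeLieAlgebra.lift ℂ g) := by
    apply FreeLieAlgebra.hom_ext
    rintro (y | u | x) <;> simp only [LieHom.comp_apply, FreeLieAlgebra.lift_of_apply] <;> rfl
  rw [h]
  exact (FreeLieAlgebra.lift ℂ g b).2

variable {L : Type*} [LieRing L] [LieAlgebra ℂ L]

/-- A linear map from a local Lie algebra to a Lie algebra that respects the brackets. -/
structure LocalHom (L : Type*) [LieRing L] [LieAlgebra ℂ L] where
  /-- The part of degree `-1`. -/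
  neg : gm →ₗ[ℂ] L
  /-- The part of degree `0`. -/
  zero : g₀ →ₗ[ℂ] L
  /-- The part of degree `1`. -/
  pos : gp →ₗ[ℂ] L
  zero_lie_zero : ∀ u u', ⁅zero u, zero u'⁆ = zero ⁅u, u'⁆
  zero_lie_pos : ∀ u x, ⁅zero u, pos x⁆ = pos ⁅u, x⁆
  zero_lie_neg : ∀ u y, ⁅zero u, neg y⁆ = neg ⁅u, y⁆
  pos_lie_neg : ∀ x y, ⁅pos x, neg y⁆ = zero (Γ.pairing x y)

variable {Γ}

namespace LocalHom

/-- The extension to the free Lie algebra. -/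
noncomputable def freeLift (φ : Γ.LocalHom L) : Γ.FreeOn →ₗ⁅ℂ⁆ L :=
  FreeLieAlgebra.lift ℂ (Sum.elim φ.neg (Sum.elim φ.zero φ.pos))

@[simp] theorem freeLift_neg (φ : Γ.LocalHom L) (y : gm) :
    φ.freeLift (Γ.freeNeg y) = φ.neg y := by
  simp [freeLift, freeNeg]

@[simp] theorem freeLift_zero (φ : Γ.LocalHom L) (u : g₀) :
    φ.freeLift (Γ.freeZero u) = φ.zero u := by
  simp [freeLift, freeZero]

@[simp] theorem freeLift_pos (φ : Γ.LocalHom L) (x : gp) :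
    φ.freeLift (Γ.freePos x) = φ.pos x := by
  simp [freeLift, freePos]

theorem relationIdeal_le_ker (φ : Γ.LocalHom L) : Γ.relationIdeal ≤ φ.freeLift.ker := by
  refine LieSubmodule.lieSpan_le.2 ?_
  rintro _ (_ | _ | _ | _ | _ | _ | _ | _ | _ | _) <;>
    simp [LieHom.mem_ker, zero_lie_zero, zero_lie_pos, zero_lie_neg, pos_lie_neg]

/-- The universal property of the maximal graded Lie algebra. -/
noncomputable def lift (φ : Γ.LocalHom L) : Γ.gMax →ₗ⁅ℂ⁆ L where
  toLinearMap := Γ.relationIdeal.toSubmodule.liftQ (φ.freeLift : Γ.FreeOn →ₗ[ℂ] L)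
    fun _ h => φ.relationIdeal_le_ker h
  map_lie' := by
    intro a b
    obtain ⟨a, rfl⟩ := Γ.maxMk_surjective a
    obtain ⟨b, rfl⟩ := Γ.maxMk_surjective b
    exact φ.freeLift.map_lie a b

@[simp] theorem lift_maxNeg (φ : Γ.LocalHom L) (y : gm) : φ.lift (Γ.maxNeg y) = φ.neg y :=
  φ.freeLift_neg y

@[simp] theorem lift_maxZero (φ : Γ.LocalHom L) (u : g₀) : φ.lift (Γ.maxZero u) = φ.zero u :=
  φ.freeLift_zero u

@[simp] theorem lift_maxPos (φ : Γ.LocalHom L) (x : gp) : φ.lift (Γ.maxPos x) = φ.pos x :=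
  φ.freeLift_pos x

end LocalHom

end Lift

/-! ### The representation of `Γ` coinduced from a `g₀`-module `N`. -/

section Coinduced

attribute [local instance] LieRing.ofAssociativeRing

variable {gm g₀ gp N ι : Type*} [LieRing g₀] [LieAlgebra ℂ g₀]
  [AddCommGroup gm] [Module ℂ gm] [LieRingModule g₀ gm] [LieModule ℂ g₀ gm]
  [AddCommGroup gp] [Module ℂ gp] [LieRingModule g₀ gp] [LieModule ℂ g₀ gp]
  [AddCommGroup N] [Module ℂ N] [LieRingModule g₀ N] [LieModule ℂ g₀ N]
  (Γ : LocalLieAlgebra gm g₀ gp) (b : Module.Basis ι ℂ gm)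

variable (N) in
/-- The operator that evaluates a function of lists at lists with one more entry. -/
def shift (i : ι) : Module.End ℂ (List ι → N) where
  toFun F l := F (i :: l)
  map_add' _ _ := rfl
  map_smul' _ _ := rfl

variable (N) in
/-- The action of degree `-1` on the coinduced module. -/
noncomputable def coindNeg : gm →ₗ[ℂ] Module.End ℂ (List ι → N) := b.constr ℂ (shift N)

@[simp] theorem coindNeg_basis (i : ι) : coindNeg N b (b i) = shift N i := by
  simp [coindNeg]

variable (N) in
/-- The values at a list of the action of degree `0` on the coinduced module. -/
noncomputable def coindZeroAux : List ι → g₀ →ₗ[ℂ] (List ι → N) →ₗ[ℂ] N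
  | [] => (LinearMap.lcomp ℂ N (LinearMap.proj [])) ∘ₗ (LieModule.toEnd ℂ g₀ N : g₀ →ₗ[ℂ] Module.End ℂ N)
  -- A list is a word in the basis of `gm`, and `F (i :: l)` is the value at `l` of `b i` applied to
  -- `F`. The recursion is forced by the relation `y u = u y - [u, y]` with `y = b i`.
  | i :: l => (LinearMap.lcomp ℂ N (shift N i)) ∘ₗ coindZeroAux l -
      (LinearMap.llcomp ℂ (List ι → N) (List ι → N) N (LinearMap.proj l)) ∘ₗ
        coindNeg N b ∘ₗ (LieModule.toEnd ℂ g₀ gm : g₀ →ₗ[ℂ] Module.End ℂ gm).flip (b i)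

variable (N) in
/-- The action of degree `0` on the coinduced module. -/
noncomputable def coindZero : g₀ →ₗ[ℂ] Module.End ℂ (List ι → N) :=
  LinearMap.mk₂ ℂ (fun u F l => coindZeroAux N b l u F)
    (fun _ _ _ => funext fun _ => by simp) (fun _ _ _ => funext fun _ => by simp)
    (fun _ _ _ => funext fun _ => by simp) (fun _ _ _ => funext fun _ => by simp)

variable (N) in
/-- The values at a list of the action of degree `1` on the coinduced module. -/
noncomputable def coindPosAux : List ι → gp →ₗ[ℂ] (List ι → N) →ₗ[ℂ] N
  -- Degree `1` acts by zero on `N`; longer lists are then forced by `y x = x y - [x, y]`.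
  | [] => 0
  | i :: l => (LinearMap.lcomp ℂ N (shift N i)) ∘ₗ coindPosAux l -
      (LinearMap.llcomp ℂ (List ι → N) (List ι → N) N (LinearMap.proj l)) ∘ₗ
        coindZero N b ∘ₗ Γ.pairing.flip (b i)

variable (N) in
/-- The action of degree `1` on the coinduced module. -/
noncomputable def coindPos : gp →ₗ[ℂ] Module.End ℂ (List ι → N) :=
  LinearMap.mk₂ ℂ (fun x F l => coindPosAux N Γ b l x F)
    (fun _ _ _ => funext fun _ => by simp) (fun _ _ _ => funext fun _ => by simp)
    (fun _ _ _ => funext fun _ => by simp) (fun _ _ _ => funext fun _ => by simp)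

theorem coindZero_nil (u : g₀) (F : List ι → N) : coindZero N b u F [] = ⁅u, F []⁆ := rfl

theorem coindPos_nil (x : gp) (F : List ι → N) : coindPos N Γ b x F [] = 0 := rfl

theorem coindZero_lie_coindNeg (u : g₀) (y : gm) :
    ⁅coindZero N b u, coindNeg N b y⁆ = coindNeg N b ⁅u, y⁆ := by
  suffices h : (LieModule.toEnd ℂ (Module.End ℂ (List ι → N)) _ (coindZero N b u)) ∘ₗ coindNeg N b =
      coindNeg N b ∘ₗ LieModule.toEnd ℂ g₀ gm u from LinearMap.congr_fun h y
  refine b.ext fun i => ?_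
  ext F l
  have h : coindZero N b u F (i :: l) = coindZero N b u (shift N i F) l -
    coindNeg N b ⁅u, b i⁆ F l := rfl
  have h' : shift N i (coindZero N b u F) l = coindZero N b u F (i :: l) := rfl
  simp [LieRing.of_associative_ring_bracket, h, h']

theorem coindPos_lie_coindNeg (x : gp) (y : gm) :
    ⁅coindPos N Γ b x, coindNeg N b y⁆ = coindZero N b (Γ.pairing x y) := by
  suffices h : (LieModule.toEnd ℂ (Module.End ℂ (List ι → N)) _ (coindPos N Γ b x)) ∘ₗ
      coindNeg N b = coindZero N b ∘ₗ Γ.pairing x from LinearMap.congr_fun h y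
  refine b.ext fun i => ?_
  ext F l
  have h : coindPos N Γ b x F (i :: l) = coindPos N Γ b x (shift N i F) l -
    coindZero N b (Γ.pairing x (b i)) F l := rfl
  have h' : shift N i (coindPos N Γ b x F) l = coindPos N Γ b x F (i :: l) := rfl
  simp [LieRing.of_associative_ring_bracket, h, h']

/-- An operator on the coinduced module is determined by its commutators with the action of degree
`-1` and the values at the empty list. -/
theorem eq_zero_of_lie_coindNeg {T : Module.End ℂ (List ι → N)}
    (hT : ∀ y, ⁅T, coindNeg N b y⁆ = 0) (h : ∀ F, T F [] = 0) : T = 0 := by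
  ext F l
  induction l generalizing F with
  | nil => exact h F
  | cons i l ih =>
    have := congrFun (LinearMap.congr_fun (hT (b i)) F) l
    simp only [LieRing.of_associative_ring_bracket, coindNeg_basis, LinearMap.sub_apply,
      Module.End.mul_apply, Pi.sub_apply, LinearMap.zero_apply, Pi.zero_apply, ih, zero_sub,
      neg_eq_zero] at this
    exact this

/-- By the Jacobi identity the difference of the two sides commutes with the action of degree `-1`;
at the empty list it vanishes because `N` is a `g₀`-module. The same scheme handles degrees `(0,
1)`, using the Jacobi identity of `Γ`. -/
theorem coindZero_lie_coindZero (u u' : g₀) :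
    ⁅coindZero N b u, coindZero N b u'⁆ = coindZero N b ⁅u, u'⁆ := by
  rw [← sub_eq_zero]
  refine eq_zero_of_lie_coindNeg b (fun y => ?_) (fun F => ?_)
  · simp [coindZero_lie_coindNeg, lie_lie]
  · simp [LieRing.of_associative_ring_bracket, coindZero_nil, lie_lie]

theorem coindZero_lie_coindPos (u : g₀) (x : gp) :
    ⁅coindZero N b u, coindPos N Γ b x⁆ = coindPos N Γ b ⁅u, x⁆ := by
  rw [← sub_eq_zero]
  refine eq_zero_of_lie_coindNeg b (fun y => ?_) (fun F => ?_)
  · simp [coindZero_lie_coindNeg, coindPos_lie_coindNeg, coindZero_lie_coindZero, lie_lie,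
      Γ.lie_pairing]
  · simp [LieRing.of_associative_ring_bracket, coindZero_nil, coindPos_nil]

variable (N) in
/-- The coinduced module as a representation of the local Lie algebra. -/
noncomputable def coind : Γ.LocalHom (Module.End ℂ (List ι → N)) where
  neg := coindNeg N b
  zero := coindZero N b
  pos := coindPos N Γ b
  zero_lie_zero := coindZero_lie_coindZero b
  zero_lie_pos := coindZero_lie_coindPos Γ b
  zero_lie_neg := coindZero_lie_coindNeg b
  pos_lie_neg := coindPos_lie_coindNeg Γ b

end Coinduced

/-! ### Faithfulness of degrees `0` and `1` in the maximal algebra. -/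

section Injective

attribute [local instance] LieRing.ofAssociativeRing

variable {gm g₀ gp : Type*} [LieRing g₀] [LieAlgebra ℂ g₀]
  [AddCommGroup gm] [Module ℂ gm] [LieRingModule g₀ gm] [LieModule ℂ g₀ gm]
  [AddCommGroup gp] [Module ℂ gp] [LieRingModule g₀ gp] [LieModule ℂ g₀ gp]
  {Γ : LocalLieAlgebra gm g₀ gp}

/-- Take `N = gp` in the coinduced module: applied to the constant function `x` and evaluated at the
empty list, `u` gives `⁅u, x⁆`. -/
theorem IsTransitive.maxZero_eq_zero (h : Γ.IsTransitive) {u : g₀} (hu : Γ.maxZero u = 0) :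
    u = 0 := by
  refine h.zero_pos u fun x => ?_
  have := (coind gp Γ (Module.Basis.ofVectorSpace ℂ gm)).lift_maxZero u
  rw [hu, map_zero] at this
  exact (congrFun (LinearMap.congr_fun this fun _ => x) []).symm

theorem IsTransitive.maxPos_eq_zero (h : Γ.IsTransitive) {x : gp} (hx : Γ.maxPos x = 0) :
    x = 0 := by
  refine h.pos_neg x fun y => h.maxZero_eq_zero ?_
  rw [← maxPos_lie_maxNeg, hx, zero_lie]

end Injective

end LocalLieAlgebra

/-! ### Gradings detected by the scaling endomorphisms. -/

/-- In the quotient by `p` the images of the `z i` lie in independent eigenspaces and sum to zero,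
so each image is zero. -/
theorem Submodule.mem_of_sum_eigenvectors_mem {K M ι : Type*} [Field K] [AddCommGroup M]
    [Module K M] {f : Module.End K M} {p : Submodule K M} (hp : ∀ x ∈ p, f x ∈ p) {c : ι → K}
    (hc : Function.Injective c) (s : Finset ι) {z : ι → M} (hz : ∀ i ∈ s, f (z i) = c i • z i)
    (h : ∑ i ∈ s, z i ∈ p) : ∀ i ∈ s, z i ∈ p := by
  have hind := (Module.End.eigenspaces_iSupIndep (p.mapQ p f hp)).comp hc
  intro i hi
  have := (iSupIndep_iff_finsetSum_eq_zero_imp_eq_zero _).1 hind s (fun i => p.mkQ (z i))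
    (fun i hi => by
      simp only [Function.comp_apply, Module.End.mem_eigenspace_iff]
      rw [← map_smul, ← hz i hi]
      rfl)
    (by rw [← map_sum]; exact (Submodule.Quotient.mk_eq_zero p).2 h) i hi
  simpa using this

namespace LocalLieAlgebra

variable {gm g₀ gp : Type*} [LieRing g₀] [LieAlgebra ℂ g₀]
  [AddCommGroup gm] [Module ℂ gm] [LieRingModule g₀ gm] [LieModule ℂ g₀ gm]
  [AddCommGroup gp] [Module ℂ gp] [LieRingModule g₀ gp] [LieModule ℂ g₀ gp]
  (Γ : LocalLieAlgebra gm g₀ gp)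

section Scale

/-- The local homomorphism that multiplies the part of degree `n` by `t ^ n`. -/
noncomputable def localScale (t : ℂˣ) : Γ.LocalHom Γ.gMax where
  neg := (t⁻¹ : ℂ) • Γ.maxNegₗ
  zero := Γ.maxZeroₗ
  pos := (t : ℂ) • Γ.maxPosₗ
  zero_lie_zero := Γ.maxZero_lie_maxZero
  zero_lie_pos u x := by simp [maxZero_lie_maxPos]
  zero_lie_neg u y := by simp [maxZero_lie_maxNeg]
  pos_lie_neg x y := by simp [maxPos_lie_maxNeg]

/-- The endomorphism of the maximal graded Lie algebra that multiplies the part of degree `n` by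
`t ^ n`. -/
noncomputable def scale (t : ℂˣ) : Γ.gMax →ₗ⁅ℂ⁆ Γ.gMax := (Γ.localScale t).lift

variable {Γ}

theorem IsMonomial.scale_eq {n : ℤ} {a : Γ.gMax} (h : Γ.IsMonomial n a) (t : ℂˣ) :
    Γ.scale t a = (t : ℂ) ^ n • a := by
  induction h with
  | neg y => simp [scale, localScale]
  | zero u => simp [scale, localScale]
  | pos x => simp [scale, localScale]
  | @lie m n _ _ _ _ ha hb => simp [ha, hb, zpow_add₀ t.ne_zero, smul_smul, mul_comm]

theorem scale_eq_of_mem {n : ℤ} {a : Γ.gMax} (h : a ∈ Γ.gMaxDegree n) (t : ℂˣ) :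
    Γ.scale t a = (t : ℂ) ^ n • a := by
  have : Γ.gMaxDegree n ≤ Module.End.eigenspace (Γ.scale t : Γ.gMax →ₗ[ℂ] Γ.gMax) ((t : ℂ) ^ n) :=
    Submodule.span_le.2 fun b hb => Module.End.mem_eigenspace_iff.2 (hb.scale_eq t)
  exact Module.End.mem_eigenspace_iff.1 (this h)

theorem maxNeg_mem (y : gm) : Γ.maxNeg y ∈ Γ.gMaxDegree (-1) := Submodule.subset_span (.neg y)

theorem maxZero_mem (u : g₀) : Γ.maxZero u ∈ Γ.gMaxDegree 0 := Submodule.subset_span (.zero u)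

theorem maxPos_mem (x : gp) : Γ.maxPos x ∈ Γ.gMaxDegree 1 := Submodule.subset_span (.pos x)

theorem lie_mem_gMaxDegree {m n : ℤ} {a b : Γ.gMax} (ha : a ∈ Γ.gMaxDegree m)
    (hb : b ∈ Γ.gMaxDegree n) : ⁅a, b⁆ ∈ Γ.gMaxDegree (m + n) := by
  induction ha, hb using Submodule.span_induction₂ with
  | mem_mem a b ha hb => exact Submodule.subset_span (.lie ha hb)
  | zero_left => simp
  | zero_right => simp
  | add_left _ _ _ _ _ _ h h' => rw [add_lie]; exact add_mem h h'
  | add_right _ _ _ _ _ _ h h' => rw [lie_add]; exact add_mem h h'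
  | smul_left c _ _ _ _ h => rw [smul_lie]; exact Submodule.smul_mem _ c h
  | smul_right c _ _ _ _ h => rw [lie_smul]; exact Submodule.smul_mem _ c h

variable (Γ) in
theorem iSup_gMaxDegree : ⨆ n, Γ.gMaxDegree n = ⊤ := by
  let S : LieSubalgebra ℂ Γ.gMax :=
    { toSubmodule := ⨆ n, Γ.gMaxDegree n
      lie_mem' := by
        intro a b ha hb
        change a ∈ ⨆ n, Γ.gMaxDegree n at ha
        change b ∈ ⨆ n, Γ.gMaxDegree n at hb
        change ⁅a, b⁆ ∈ ⨆ n, Γ.gMaxDegree n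
        induction ha using Submodule.iSup_induction' with
        | zero => simp
        | add _ _ _ _ h h' => rw [add_lie]; exact add_mem h h'
        | mem m a ha =>
          induction hb using Submodule.iSup_induction' with
          | zero => simp
          | add _ _ _ _ h h' => rw [lie_add]; exact add_mem h h'
          | mem n b hb =>
            exact Submodule.mem_iSup_of_mem (m + n) (lie_mem_gMaxDegree ha hb) }
  exact eq_top_iff.2 fun a _ => Γ.mem_of_generators S
    (fun y => Submodule.mem_iSup_of_mem (-1) (maxNeg_mem y))
    (fun u => Submodule.mem_iSup_of_mem 0 (maxZero_mem u))
    (fun x => Submodule.mem_iSup_of_mem 1 (maxPos_mem x)) a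

/-- The number `2` as a unit, whose powers are pairwise distinct. -/
noncomputable def two : ℂˣ := Units.mk0 2 two_ne_zero

theorem two_zpow_injective : Function.Injective fun n : ℤ => (two : ℂ) ^ n := by
  intro m n h
  have h2 : ((2 : ℝ) : ℂ) ^ m = ((2 : ℝ) : ℂ) ^ n := by simpa [two] using h
  rw [← Complex.ofReal_zpow, ← Complex.ofReal_zpow, Complex.ofReal_inj] at h2
  exact zpow_right_injective₀ (by norm_num) (by norm_num) h2

/-- Homogeneous components of an element of a submodule that is stable under scaling. -/
theorem mem_of_sum_mem {p : Submodule ℂ Γ.gMax} (hp : ∀ a ∈ p, Γ.scale two a ∈ p) (s : Finset ℤ)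
    {z : ℤ → Γ.gMax} (hz : ∀ n ∈ s, z n ∈ Γ.gMaxDegree n) (h : ∑ n ∈ s, z n ∈ p) :
    ∀ n ∈ s, z n ∈ p :=
  Submodule.mem_of_sum_eigenvectors_mem (f := (Γ.scale two : Γ.gMax →ₗ[ℂ] Γ.gMax)) hp
    two_zpow_injective s (fun n hn => scale_eq_of_mem (hz n hn) two) h

theorem IsGradedIdeal.scale_mem {J : LieIdeal ℂ Γ.gMax} (h : Γ.IsGradedIdeal J) (t : ℂˣ)
    {a : Γ.gMax} (ha : a ∈ J) : Γ.scale t a ∈ J := by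
  have ha' : a ∈ ⨆ n : ℤ, J.toSubmodule ⊓ Γ.gMaxDegree n := h ▸ ha
  induction ha' using Submodule.iSup_induction' with
  | zero => simp
  | add a b hha hhb h1 h2 =>
    rw [map_add]
    rw [← h] at hha hhb
    exact add_mem (h1 hha) (h2 hhb)
  | mem n a h1 =>
    rw [scale_eq_of_mem h1.2]
    exact J.smul_mem _ ha

/-- Homogeneous components are eigenvectors of `scale two` with distinct eigenvalues `2 ^ n`, so a
stable subspace contains them. -/
theorem isGradedIdeal_of_scale_mem {J : LieIdeal ℂ Γ.gMax} (h : ∀ a ∈ J, Γ.scale two a ∈ J) :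
    Γ.IsGradedIdeal J := by
  refine le_antisymm (fun a ha => ?_) (iSup_le fun n => inf_le_left)
  have ha' : a ∈ ⨆ n, Γ.gMaxDegree n := by rw [iSup_gMaxDegree]; trivial
  obtain ⟨f, hf, rfl⟩ := (Submodule.mem_iSup_iff_exists_finsupp _ _).1 ha'
  have := mem_of_sum_mem (p := J.toSubmodule) h f.support (fun n _ => hf n) ha
  exact sum_mem fun n hn => Submodule.mem_iSup_of_mem n ⟨this n hn, hf n⟩

end Scale

/-! ### Degrees `-1, 0, 1` of the maximal algebra come from the local part. -/

section LocalDegrees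

/-- Left-normed brackets of elements of degree `1`, or of degree `-1`, and the elements of degree
`0`. -/
inductive IsLeftNormed : ℤ → Γ.gMax → Prop
  | neg (y : gm) : IsLeftNormed (-1) (Γ.maxNeg y)
  | zero (u : g₀) : IsLeftNormed 0 (Γ.maxZero u)
  | pos (x : gp) : IsLeftNormed 1 (Γ.maxPos x)
  | lie_neg {n : ℤ} {a : Γ.gMax} (y : gm) : n < 0 → IsLeftNormed n a →
      IsLeftNormed (-1 + n) ⁅Γ.maxNeg y, a⁆
  | lie_pos {n : ℤ} {a : Γ.gMax} (x : gp) : 0 < n → IsLeftNormed n a →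
      IsLeftNormed (1 + n) ⁅Γ.maxPos x, a⁆

/-- The span of the left-normed brackets of degree `n`. -/
noncomputable def leftNormed (n : ℤ) : Submodule ℂ Γ.gMax :=
  Submodule.span ℂ {a | Γ.IsLeftNormed n a}

variable {Γ}

theorem lie_mem_leftNormed_of_forall {c : Γ.gMax} {n k : ℤ}
    (h : ∀ a, Γ.IsLeftNormed n a → ⁅c, a⁆ ∈ Γ.leftNormed k) {a : Γ.gMax}
    (ha : a ∈ Γ.leftNormed n) : ⁅c, a⁆ ∈ Γ.leftNormed k := by
  have : Γ.leftNormed n ≤ (Γ.leftNormed k).comap (LieAlgebra.ad ℂ Γ.gMax c) :=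
    Submodule.span_le.2 h
  exact this ha

theorem maxNeg_mem_leftNormed (y : gm) : Γ.maxNeg y ∈ Γ.leftNormed (-1) :=
  Submodule.subset_span (.neg y)

theorem maxZero_mem_leftNormed (u : g₀) : Γ.maxZero u ∈ Γ.leftNormed 0 :=
  Submodule.subset_span (.zero u)

theorem maxPos_mem_leftNormed (x : gp) : Γ.maxPos x ∈ Γ.leftNormed 1 :=
  Submodule.subset_span (.pos x)

theorem maxNeg_lie_mem_of_neg (y : gm) {n : ℤ} (hn : n < 0) {a : Γ.gMax}
    (ha : a ∈ Γ.leftNormed n) : ⁅Γ.maxNeg y, a⁆ ∈ Γ.leftNormed (-1 + n) :=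
  lie_mem_leftNormed_of_forall (fun _ h => Submodule.subset_span (.lie_neg y hn h)) ha

theorem maxPos_lie_mem_of_pos (x : gp) {n : ℤ} (hn : 0 < n) {a : Γ.gMax}
    (ha : a ∈ Γ.leftNormed n) : ⁅Γ.maxPos x, a⁆ ∈ Γ.leftNormed (1 + n) :=
  lie_mem_leftNormed_of_forall (fun _ h => Submodule.subset_span (.lie_pos x hn h)) ha

theorem maxZero_lie_mem (u : g₀) {n : ℤ} {a : Γ.gMax} (ha : a ∈ Γ.leftNormed n) :
    ⁅Γ.maxZero u, a⁆ ∈ Γ.leftNormed n := by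
  refine lie_mem_leftNormed_of_forall (fun a h => ?_) ha
  clear ha
  induction h with
  | neg y => rw [maxZero_lie_maxNeg]; exact maxNeg_mem_leftNormed _
  | zero u => rw [maxZero_lie_maxZero]; exact maxZero_mem_leftNormed _
  | pos x => rw [maxZero_lie_maxPos]; exact maxPos_mem_leftNormed _
  | lie_neg y hn h ih =>
    rw [leibniz_lie, maxZero_lie_maxNeg]
    exact add_mem (maxNeg_lie_mem_of_neg _ hn (Submodule.subset_span h))
      (maxNeg_lie_mem_of_neg _ hn ih)
  | lie_pos y hn h ih =>
    rw [leibniz_lie, maxZero_lie_maxPos]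
    exact add_mem (maxPos_lie_mem_of_pos _ hn (Submodule.subset_span h))
      (maxPos_lie_mem_of_pos _ hn ih)

/-- Against letters of degree `1`, the Jacobi identity moves `y` inward; each letter it meets
produces an element of degree `0`, whose action preserves left-normed spans. -/
theorem IsLeftNormed.maxNeg_lie_mem {n : ℤ} {a : Γ.gMax} (h : Γ.IsLeftNormed n a) (y : gm) :
    ⁅Γ.maxNeg y, a⁆ ∈ Γ.leftNormed (-1 + n) := by
  induction h generalizing y with
  | neg y' => exact maxNeg_lie_mem_of_neg y (by norm_num) (maxNeg_mem_leftNormed y')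
  | zero u =>
    rw [← lie_skew, maxZero_lie_maxNeg]
    exact neg_mem (maxNeg_mem_leftNormed _)
  | pos x =>
    rw [maxNeg_lie_maxPos]
    exact neg_mem (maxZero_mem_leftNormed _)
  | lie_neg y' hn h ih =>
    exact maxNeg_lie_mem_of_neg y (by omega) (maxNeg_lie_mem_of_neg y' hn (Submodule.subset_span h))
  | @lie_pos n a x hn h ih =>
    rw [leibniz_lie, maxNeg_lie_maxPos, neg_lie, neg_add_cancel_left]
    refine add_mem (neg_mem (maxZero_lie_mem _ (Submodule.subset_span h))) ?_
    -- The inner degree `1` is separate: there `y` lowers the degree to `0`, where a bracket with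
    -- `x` is not a left-normed step.
    rcases h with _ | _ | x' | _ | ⟨x', hk, h'⟩
    · omega
    · omega
    · rw [maxNeg_lie_maxPos, _root_.lie_neg, ← lie_skew, neg_neg, maxZero_lie_maxPos]
      exact maxPos_mem_leftNormed _
    · omega
    · have := maxPos_lie_mem_of_pos x (by omega) (ih y)
      rwa [add_neg_cancel_left] at this

theorem IsLeftNormed.maxPos_lie_mem {n : ℤ} {a : Γ.gMax} (h : Γ.IsLeftNormed n a) (x : gp) :
    ⁅Γ.maxPos x, a⁆ ∈ Γ.leftNormed (1 + n) := by
  induction h generalizing x with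
  | pos x' => exact maxPos_lie_mem_of_pos x (by norm_num) (maxPos_mem_leftNormed x')
  | zero u =>
    rw [← lie_skew, maxZero_lie_maxPos]
    exact neg_mem (maxPos_mem_leftNormed _)
  | neg y =>
    rw [maxPos_lie_maxNeg]
    exact maxZero_mem_leftNormed _
  | lie_pos x' hn h ih =>
    exact maxPos_lie_mem_of_pos x (by omega) (maxPos_lie_mem_of_pos x' hn (Submodule.subset_span h))
  | @lie_neg n a y hn h ih =>
    rw [leibniz_lie, maxPos_lie_maxNeg, add_neg_cancel_left]
    refine add_mem (maxZero_lie_mem _ (Submodule.subset_span h)) ?_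
    rcases h with y' | _ | _ | ⟨y', hk, h'⟩ | _
    · rw [maxPos_lie_maxNeg, ← lie_skew, maxZero_lie_maxNeg]
      exact neg_mem (maxNeg_mem_leftNormed _)
    · omega
    · omega
    · have := maxNeg_lie_mem_of_neg y (by omega) (ih x)
      rwa [neg_add_cancel_left] at this
    · omega

theorem IsMonomial.lie_mem_leftNormed {m : ℤ} {c : Γ.gMax} (hc : Γ.IsMonomial m c) :
    ∀ {n : ℤ} {a : Γ.gMax}, a ∈ Γ.leftNormed n → ⁅c, a⁆ ∈ Γ.leftNormed (m + n) := by
  induction hc with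
  | neg y => exact fun ha => lie_mem_leftNormed_of_forall (fun _ h => h.maxNeg_lie_mem y) ha
  | zero u => intro n a ha; rw [zero_add]; exact maxZero_lie_mem u ha
  | pos x => exact fun ha => lie_mem_leftNormed_of_forall (fun _ h => h.maxPos_lie_mem x) ha
  | lie _ _ ih ih' =>
    intro n a ha
    rw [lie_lie]
    refine sub_mem ?_ ?_
    · rw [add_assoc]; exact ih (ih' ha)
    · rw [add_comm (_ : ℤ) (_ : ℤ), add_left_comm, add_comm n, add_left_comm]; exact ih' (ih ha)

theorem IsMonomial.mem_leftNormed {n : ℤ} {a : Γ.gMax} (h : Γ.IsMonomial n a) :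
    a ∈ Γ.leftNormed n := by
  induction h with
  | neg y => exact maxNeg_mem_leftNormed y
  | zero u => exact maxZero_mem_leftNormed u
  | pos x => exact maxPos_mem_leftNormed x
  | lie ha hb _ ih => exact ha.lie_mem_leftNormed ih

theorem gMaxDegree_le_leftNormed (n : ℤ) : Γ.gMaxDegree n ≤ Γ.leftNormed n :=
  Submodule.span_le.2 fun _ h => h.mem_leftNormed

/-- The two bracket constructors only produce degrees at most `-2` or at least `2`. -/
theorem IsLeftNormed.sign {n : ℤ} {a : Γ.gMax} (h : Γ.IsLeftNormed n a) :
    (n = -1 → ∃ y, Γ.maxNeg y = a) ∧ (n = 0 → ∃ u, Γ.maxZero u = a) ∧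
      (n = 1 → ∃ x, Γ.maxPos x = a) := by
  rcases h with y | u | x | _ | _ <;> refine ⟨fun h => ?_, fun h => ?_, fun h => ?_⟩ <;>
    first | omega | exact ⟨_, rfl⟩

theorem exists_maxNeg_of_mem {a : Γ.gMax} (h : a ∈ Γ.gMaxDegree (-1)) : ∃ y, Γ.maxNeg y = a :=
  (Submodule.span_le.2 fun _ h => h.sign.1 rfl : Γ.leftNormed (-1) ≤ Γ.maxNegₗ.range)
    (gMaxDegree_le_leftNormed _ h)

theorem exists_maxZero_of_mem {a : Γ.gMax} (h : a ∈ Γ.gMaxDegree 0) : ∃ u, Γ.maxZero u = a :=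
  (Submodule.span_le.2 fun _ h => h.sign.2.1 rfl : Γ.leftNormed 0 ≤ Γ.maxZeroₗ.range)
    (gMaxDegree_le_leftNormed _ h)

theorem exists_maxPos_of_mem {a : Γ.gMax} (h : a ∈ Γ.gMaxDegree 1) : ∃ x, Γ.maxPos x = a :=
  (Submodule.span_le.2 fun _ h => h.sign.2.2 rfl : Γ.leftNormed 1 ≤ Γ.maxPosₗ.range)
    (gMaxDegree_le_leftNormed _ h)

theorem maxNeg_mem_localPart (y : gm) : Γ.maxNeg y ∈ Γ.gMaxLocalPart :=
  Submodule.subset_span (.inl (.inl ⟨y, rfl⟩))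

theorem maxZero_mem_localPart (u : g₀) : Γ.maxZero u ∈ Γ.gMaxLocalPart :=
  Submodule.subset_span (.inl (.inr ⟨u, rfl⟩))

theorem maxPos_mem_localPart (x : gp) : Γ.maxPos x ∈ Γ.gMaxLocalPart :=
  Submodule.subset_span (.inr ⟨x, rfl⟩)

theorem exists_of_mem_localPart {a : Γ.gMax} (h : a ∈ Γ.gMaxLocalPart) :
    ∃ y u x, a = Γ.maxNeg y + Γ.maxZero u + Γ.maxPos x := by
  have : Γ.gMaxLocalPart ≤ Γ.maxNegₗ.range ⊔ Γ.maxZeroₗ.range ⊔ Γ.maxPosₗ.range := by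
    refine Submodule.span_le.2 ?_
    rintro _ ((⟨y, rfl⟩ | ⟨u, rfl⟩) | ⟨x, rfl⟩)
    · exact Submodule.mem_sup_left (Submodule.mem_sup_left ⟨y, rfl⟩)
    · exact Submodule.mem_sup_left (Submodule.mem_sup_right ⟨u, rfl⟩)
    · exact Submodule.mem_sup_right ⟨x, rfl⟩
  obtain ⟨_, hb, _, ⟨x, rfl⟩, rfl⟩ := Submodule.mem_sup.1 (this h)
  obtain ⟨_, ⟨y, rfl⟩, _, ⟨u, rfl⟩, rfl⟩ := Submodule.mem_sup.1 hb
  exact ⟨y, u, x, rfl⟩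

/-- A submodule that is stable under scaling contains the homogeneous components of each of its
elements that lie in the local part. -/
theorem components_mem {p : Submodule ℂ Γ.gMax} (hp : ∀ a ∈ p, Γ.scale two a ∈ p) {y : gm} {u : g₀}
    {x : gp} (h : Γ.maxNeg y + Γ.maxZero u + Γ.maxPos x ∈ p) :
    Γ.maxNeg y ∈ p ∧ Γ.maxZero u ∈ p ∧ Γ.maxPos x ∈ p := by
  let z : ℤ → Γ.gMax := fun n => if n = -1 then Γ.maxNeg y else if n = 0 then Γ.maxZero u else
    Γ.maxPos x
  have := mem_of_sum_mem hp {-1, 0, 1} (z := z)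
    (by simpa [z] using ⟨maxNeg_mem y, maxZero_mem u, maxPos_mem x⟩)
    (by simpa [z, add_assoc] using h)
  simpa [z] using this

end LocalDegrees

/-! ### The largest graded ideal that avoids the local part. -/

section MaximalIdeal

variable {Γ}

theorem scale_mem_maximalIdeal {a : Γ.gMax} (h : a ∈ Γ.maximalIdeal) (t : ℂˣ) :
    Γ.scale t a ∈ Γ.maximalIdeal := by
  have : Γ.maximalIdeal ≤ Γ.maximalIdeal.comap (Γ.scale t) := by
    refine sSup_le fun J hJ a ha => ?_
    exact (le_sSup hJ : J ≤ Γ.maximalIdeal) (hJ.1.scale_mem t ha)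
  exact this h

variable (Γ) in
theorem iSupIndep_gMaxDegree : iSupIndep Γ.gMaxDegree :=
  ((Module.End.eigenspaces_iSupIndep (Γ.scale two : Γ.gMax →ₗ[ℂ] Γ.gMax)).comp
    two_zpow_injective).mono fun _ _ ha => Module.End.mem_eigenspace_iff.2 (scale_eq_of_mem ha two)

theorem gMaxDegree_le_localPart {n : ℤ} (hn : n ∈ ({-1, 0, 1} : Set ℤ)) :
    Γ.gMaxDegree n ≤ Γ.gMaxLocalPart := by
  intro a ha
  rcases hn with rfl | rfl | rfl
  · obtain ⟨y, rfl⟩ := exists_maxNeg_of_mem ha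
    exact maxNeg_mem_localPart y
  · obtain ⟨u, rfl⟩ := exists_maxZero_of_mem ha
    exact maxZero_mem_localPart u
  · obtain ⟨x, rfl⟩ := exists_maxPos_of_mem ha
    exact maxPos_mem_localPart x

variable (Γ) in
theorem gMaxLocalPart_le : Γ.gMaxLocalPart ≤ ⨆ n ∈ ({-1, 0, 1} : Set ℤ), Γ.gMaxDegree n := by
  refine Submodule.span_le.2 ?_
  rintro _ ((⟨y, rfl⟩ | ⟨u, rfl⟩) | ⟨x, rfl⟩)
  · exact Submodule.mem_iSup_of_mem (-1) (Submodule.mem_iSup_of_mem (by simp) (maxNeg_mem y))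
  · exact Submodule.mem_iSup_of_mem 0 (Submodule.mem_iSup_of_mem (by simp) (maxZero_mem u))
  · exact Submodule.mem_iSup_of_mem 1 (Submodule.mem_iSup_of_mem (by simp) (maxPos_mem x))

/-- Degrees `-1, 0, 1` lie in the local part, so such an ideal lives in the other degrees. Unlike
disjointness, this containment passes to arbitrary sums of ideals. -/
theorem IsGradedIdeal.le_of_disjoint {J : LieIdeal ℂ Γ.gMax} (hJ : Γ.IsGradedIdeal J)
    (h : Disjoint J.toSubmodule Γ.gMaxLocalPart) :
    J.toSubmodule ≤ ⨆ n ∉ ({-1, 0, 1} : Set ℤ), Γ.gMaxDegree n := by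
  rw [hJ]
  refine iSup_le fun n => ?_
  by_cases hn : n ∈ ({-1, 0, 1} : Set ℤ)
  · rw [(h.mono_right (gMaxDegree_le_localPart hn)).eq_bot]
    exact bot_le
  · exact inf_le_right.trans (le_iSup₂_of_le n hn le_rfl)

variable (Γ) in
/-- The maximal ideal meets the local part trivially. -/
theorem disjoint_maximalIdeal : Disjoint Γ.maximalIdeal.toSubmodule Γ.gMaxLocalPart := by
  have h1 : Γ.maximalIdeal.toSubmodule ≤ ⨆ n ∉ ({-1, 0, 1} : Set ℤ), Γ.gMaxDegree n := by
    rw [maximalIdeal, LieSubmodule.sSup_toSubmodule]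
    refine sSup_le ?_
    rintro _ ⟨J, hJ, rfl⟩
    exact hJ.1.le_of_disjoint hJ.2
  exact (Γ.iSupIndep_gMaxDegree.disjoint_biSup_biSup disjoint_compl_left).mono h1
    Γ.gMaxLocalPart_le

theorem eq_zero_of_mem_maximalIdeal {a : Γ.gMax} (h : a ∈ Γ.maximalIdeal)
    (h' : a ∈ Γ.gMaxLocalPart) : a = 0 :=
  Submodule.disjoint_def.1 Γ.disjoint_maximalIdeal a h h'

/-- A graded ideal without nonzero elements of the form `maxNeg y`, `maxZero u` or `maxPos x` is
contained in the maximal ideal. -/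
theorem IsGradedIdeal.le_maximalIdeal {J : LieIdeal ℂ Γ.gMax} (hJ : Γ.IsGradedIdeal J)
    (hn : ∀ y, Γ.maxNeg y ∈ J → Γ.maxNeg y = 0) (hz : ∀ u, Γ.maxZero u ∈ J → Γ.maxZero u = 0)
    (hp : ∀ x, Γ.maxPos x ∈ J → Γ.maxPos x = 0) : J ≤ Γ.maximalIdeal := by
  refine le_sSup ⟨hJ, Submodule.disjoint_def.2 fun a ha ha' => ?_⟩
  obtain ⟨y, u, x, rfl⟩ := exists_of_mem_localPart ha'
  obtain ⟨h1, h2, h3⟩ := components_mem (fun _ => hJ.scale_mem two) ha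
  rw [hn y h1, hz u h2, hp x h3, add_zero, add_zero]

end MaximalIdeal

end LocalLieAlgebra

/-! ### Stability of canonical ideals, and central operators of square zero. -/

/-- The preimage of the radical under the inverse `g` embeds in the radical, so it is a solvable
ideal. -/
theorem LieIdeal.map_mem_radical {L L' : Type*} [LieRing L] [LieAlgebra ℂ L] [LieRing L']
    [LieAlgebra ℂ L'] [IsNoetherian ℂ L] [IsNoetherian ℂ L'] {f : L →ₗ⁅ℂ⁆ L'} {g : L' →ₗ⁅ℂ⁆ L}
    (hgf : ∀ x, g (f x) = x) (hfg : ∀ x, f (g x) = x) {x : L} (hx : x ∈ LieAlgebra.radical ℂ L) :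
    f x ∈ LieAlgebra.radical ℂ L' := by
  have h : LieAlgebra.IsSolvable ((LieAlgebra.radical ℂ L).comap g) := by
    let φ : (LieAlgebra.radical ℂ L).comap g →ₗ⁅ℂ⁆ LieAlgebra.radical ℂ L :=
      { toFun := fun z => ⟨g z.1, z.2⟩
        map_add' := fun _ _ => Subtype.ext (map_add g _ _)
        map_smul' := fun _ _ => Subtype.ext (map_smul g _ _)
        map_lie' := Subtype.ext (g.map_lie _ _) }
    have hφ : Function.Injective φ := fun a b hab => Subtype.ext <| by
      have : g a = g b := congrArg Subtype.val hab
      rw [← hfg a, this, hfg]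
    exact hφ.lieAlgebra_isSolvable
  refine (LieAlgebra.LieIdeal.solvable_iff_le_radical ℂ L' _).1 h ?_
  rw [LieIdeal.mem_comap, hgf]
  exact hx

theorem LieIdeal.map_mem_lie {L : Type*} [LieRing L] [LieAlgebra ℂ L] {I J : LieIdeal ℂ L}
    {f : L →ₗ⁅ℂ⁆ L} (hI : ∀ x ∈ I, f x ∈ I) (hJ : ∀ x ∈ J, f x ∈ J) {x : L} (hx : x ∈ ⁅I, J⁆) :
    f x ∈ ⁅I, J⁆ := by
  have h : ⁅I, J⁆ ≤ ⁅I, J⁆.comap f := by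
    rw [LieSubmodule.lie_le_iff]
    intro a ha b hb
    rw [LieIdeal.mem_comap, LieHom.map_lie]
    exact LieSubmodule.lie_mem_lie (hI a ha) (hJ b hb)
  exact h hx

theorem LieIdeal.map_mem_derivedSeriesOfIdeal {L : Type*} [LieRing L] [LieAlgebra ℂ L]
    {I : LieIdeal ℂ L} {f : L →ₗ⁅ℂ⁆ L} (hI : ∀ x ∈ I, f x ∈ I) (k : ℕ) :
    ∀ x ∈ LieAlgebra.derivedSeriesOfIdeal ℂ L k I,
      f x ∈ LieAlgebra.derivedSeriesOfIdeal ℂ L k I := by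
  induction k with
  | zero => exact hI
  | succ k ih =>
    rw [LieAlgebra.derivedSeriesOfIdeal_succ]
    exact fun x hx => LieIdeal.map_mem_lie ih ih hx

theorem LieIdeal.map_mem_derivedAbelianOfIdeal {L : Type*} [LieRing L] [LieAlgebra ℂ L]
    {I : LieIdeal ℂ L} {f : L →ₗ⁅ℂ⁆ L} (hI : ∀ x ∈ I, f x ∈ I) :
    ∀ x ∈ LieAlgebra.derivedAbelianOfIdeal I, f x ∈ LieAlgebra.derivedAbelianOfIdeal I := by
  unfold LieAlgebra.derivedAbelianOfIdeal
  -- Derived length `0` gives `⊥` by convention; otherwise the ideal is the term of the derived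
  -- series just before it vanishes.
  split
  · intro x hx
    rw [LieSubmodule.mem_bot] at hx ⊢
    rw [hx, map_zero]
  · exact LieIdeal.map_mem_derivedSeriesOfIdeal hI _

/-- A central element of a Lie algebra acts trivially on a completely reducible module if its square
does. -/
theorem LieModule.lie_eq_zero_of_central_of_sq {L V : Type*} [LieRing L] [LieAlgebra ℂ L]
    [AddCommGroup V] [Module ℂ V] [LieRingModule L V] [LieModule ℂ L V]
    [ComplementedLattice (LieSubmodule ℂ L V)] {u : L} (hu : ∀ w : L, ⁅w, u⁆ = 0)
    (h : ∀ x : V, ⁅u, ⁅u, x⁆⁆ = 0) (x : V) : ⁅u, x⁆ = 0 := by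
  let K : LieSubmodule ℂ L V :=
    { toSubmodule := (LieModule.toEnd ℂ L V u).ker
      lie_mem := by
        intro w m hm
        have hm' : ⁅u, m⁆ = 0 := hm
        change ⁅u, ⁅w, m⁆⁆ = 0
        rw [leibniz_lie, hm', lie_zero, add_zero, ← lie_skew, hu, neg_zero, zero_lie] }
  have hK : ∀ m, m ∈ K ↔ ⁅u, m⁆ = 0 := fun _ => Iff.rfl
  obtain ⟨C, hC⟩ := exists_isCompl K
  have hx : x ∈ K ⊔ C := hC.sup_eq_top ▸ LieSubmodule.mem_top x
  obtain ⟨a, ha, c, hc, rfl⟩ := (LieSubmodule.mem_sup _ _ _).1 hx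
  -- The image of `u` lies in its kernel since `u` squares to zero, while `C` is stable under `u`.
  have h0 : ⁅u, c⁆ ∈ K ⊓ C := ⟨(hK _).2 (h c), C.lie_mem hc⟩
  rw [hC.inf_eq_bot, LieSubmodule.mem_bot] at h0
  rw [lie_add, (hK a).1 ha, h0, add_zero]

/-! ### The minimal graded Lie algebra and its semisimplicity. -/

namespace LocalLieAlgebra

variable {gm g₀ gp : Type*} [LieRing g₀] [LieAlgebra ℂ g₀]
  [AddCommGroup gm] [Module ℂ gm] [LieRingModule g₀ gm] [LieModule ℂ g₀ gm]
  [AddCommGroup gp] [Module ℂ gp] [LieRingModule g₀ gp] [LieModule ℂ g₀ gp]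
  (Γ : LocalLieAlgebra gm g₀ gp)

/-- The projection from the maximal to the minimal graded Lie algebra. -/
noncomputable def minMk : Γ.gMax →ₗ⁅ℂ⁆ Γ.gMin where
  toLinearMap := Γ.maximalIdeal.toSubmodule.mkQ
  map_lie' := rfl

theorem minMk_surjective : Function.Surjective Γ.minMk := Quot.mk_surjective

theorem minMk_eq_zero {a : Γ.gMax} : Γ.minMk a = 0 ↔ a ∈ Γ.maximalIdeal :=
  LieSubmodule.Quotient.mk_eq_zero' (N := Γ.maximalIdeal)

/-- The endomorphism of the minimal graded Lie algebra that multiplies the part of degree `n` by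
`t ^ n`. -/
noncomputable def minScale (t : ℂˣ) : Γ.gMin →ₗ⁅ℂ⁆ Γ.gMin where
  toLinearMap := Γ.maximalIdeal.toSubmodule.mapQ Γ.maximalIdeal.toSubmodule
    (Γ.scale t : Γ.gMax →ₗ[ℂ] Γ.gMax) fun _ h => scale_mem_maximalIdeal h t
  map_lie' := by
    intro a b
    obtain ⟨a, rfl⟩ := Γ.minMk_surjective a
    obtain ⟨b, rfl⟩ := Γ.minMk_surjective b
    exact congrArg Γ.minMk ((Γ.scale t).map_lie a b)

variable {Γ}

theorem minScale_minMk (t : ℂˣ) (a : Γ.gMax) : Γ.minScale t (Γ.minMk a) = Γ.minMk (Γ.scale t a) :=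
  rfl

theorem scale_inv_scale (t : ℂˣ) (a : Γ.gMax) : Γ.scale t⁻¹ (Γ.scale t a) = a := by
  have ha : a ∈ ⨆ n, Γ.gMaxDegree n := by rw [iSup_gMaxDegree]; trivial
  induction ha using Submodule.iSup_induction' with
  | zero => simp
  | add _ _ _ _ h h' => rw [map_add, map_add, h, h']
  | mem n a ha =>
    rw [scale_eq_of_mem ha, map_smul, scale_eq_of_mem ha, smul_smul, Units.val_inv_eq_inv_val,
      inv_zpow, mul_inv_cancel₀ (zpow_ne_zero _ t.ne_zero), one_smul]

theorem minScale_inv_minScale (t : ℂˣ) (a : Γ.gMin) : Γ.minScale t⁻¹ (Γ.minScale t a) = a := by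
  obtain ⟨a, rfl⟩ := Γ.minMk_surjective a
  rw [minScale_minMk, minScale_minMk, scale_inv_scale]

theorem minScale_mem_radical [IsNoetherian ℂ Γ.gMin] (t : ℂˣ) :
    ∀ a ∈ LieAlgebra.radical ℂ Γ.gMin, Γ.minScale t a ∈ LieAlgebra.radical ℂ Γ.gMin :=
  fun _ => LieIdeal.map_mem_radical (g := Γ.minScale t⁻¹) (minScale_inv_minScale t) fun a => by
    simpa using minScale_inv_minScale t⁻¹ a

/-- If the part of degree `0` of a transitive local Lie algebra is reductive and acts completely
reducibly on the part of degree `1`, then an abelian ideal of the minimal graded Lie algebra that is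
stable under scaling is zero. -/
theorem IsTransitive.eq_bot_of_isLieAbelian [IsNoetherian ℂ g₀] [LieAlgebra.HasCentralRadical ℂ g₀]
    [ComplementedLattice (LieSubmodule ℂ g₀ gp)] (h : Γ.IsTransitive) {A : LieIdeal ℂ Γ.gMin}
    (hA : ∀ a ∈ A, ∀ b ∈ A, ⁅a, b⁆ = 0) (hs : ∀ a ∈ A, Γ.minScale two a ∈ A) : A = ⊥ := by
  let J : LieIdeal ℂ Γ.gMax := A.comap Γ.minMk
  have hJ : Γ.IsGradedIdeal J := isGradedIdeal_of_scale_mem fun a ha => hs _ ha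
  -- As `A` is abelian, brackets within `J` fall in the maximal ideal, which meets the local part
  -- only in `0`.
  have hab : ∀ a ∈ J, ∀ b ∈ J, ⁅a, b⁆ ∈ Γ.gMaxLocalPart → ⁅a, b⁆ = 0 := fun a ha b hb =>
    eq_zero_of_mem_maximalIdeal (Γ.minMk_eq_zero.1 ((Γ.minMk.map_lie a b).trans (hA _ ha _ hb)))
  have hz : ∀ u, Γ.maxZero u ∈ J → u = 0 := by
    let I : LieIdeal ℂ g₀ :=
      { toSubmodule := J.toSubmodule.comap Γ.maxZeroₗ
        lie_mem := by
          intro w u hu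
          change Γ.maxZero ⁅w, u⁆ ∈ J
          rw [← maxZero_lie_maxZero]
          exact J.lie_mem hu }
    have hI : IsLieAbelian I := ⟨fun a b => Subtype.ext <| h.maxZero_eq_zero <| by
      change Γ.maxZero ⁅a.1, b.1⁆ = 0
      have := hab _ a.2 _ b.2
      simp only [maxZeroₗ_apply, maxZero_lie_maxZero] at this
      exact this (maxZero_mem_localPart _)⟩
    have hle : I ≤ LieAlgebra.center ℂ g₀ := by
      -- Reductivity enters here: an abelian ideal is solvable, hence inside the radical, which is
      -- the center.
      rw [← LieAlgebra.radical_eq_center, ← LieAlgebra.LieIdeal.solvable_iff_le_radical]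
      infer_instance
    intro u hu
    have hc : ∀ w : g₀, ⁅w, u⁆ = 0 := hle (show u ∈ I from hu)
    refine h.zero_pos u (LieModule.lie_eq_zero_of_central_of_sq hc fun x => h.maxPos_eq_zero ?_)
    -- Both `u` and `⁅u, x⁆` give elements of `J`, so their bracket, the image of `⁅u, ⁅u, x⁆⁆`,
    -- vanishes.
    have hx : Γ.maxPos ⁅u, x⁆ ∈ J := by
      rw [← maxZero_lie_maxPos]
      exact lie_mem_left ℂ Γ.gMax J _ _ hu
    have := hab _ hu _ hx
    rw [maxZero_lie_maxPos] at this
    exact this (maxPos_mem_localPart _)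
  have hle : J ≤ Γ.maximalIdeal := by
    refine hJ.le_maximalIdeal (fun y hy => ?_) (fun u hu => ?_) (fun x hx => ?_)
    -- Every `Γ.pairing x y` has its image in `J`, so it is zero by the degree-zero case;
    -- transitivity then kills `y`. Degree `1` is symmetric.
    · rw [h.neg_pos y fun x => hz _ ?_, ← maxNegₗ_apply, map_zero]
      rw [← maxPos_lie_maxNeg]
      exact J.lie_mem hy
    · rw [hz u hu, ← maxZeroₗ_apply, map_zero]
    · rw [h.pos_neg x fun y => hz _ ?_, ← maxPosₗ_apply, map_zero]
      rw [← maxPos_lie_maxNeg]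
      exact lie_mem_left ℂ Γ.gMax J _ _ hx
  refine (LieSubmodule.eq_bot_iff _).2 fun a ha => ?_
  obtain ⟨a, rfl⟩ := Γ.minMk_surjective a
  exact Γ.minMk_eq_zero.2 (hle ha)

/-- If the part of degree `0` of a transitive local Lie algebra is reductive and acts completely
reducibly on the part of degree `1`, then the minimal graded Lie algebra is semisimple as soon as it
is finite-dimensional. -/
theorem IsTransitive.isSemisimple_gMin [IsNoetherian ℂ g₀] [LieAlgebra.HasCentralRadical ℂ g₀]
    [ComplementedLattice (LieSubmodule ℂ g₀ gp)] [FiniteDimensional ℂ Γ.gMin]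
    (h : Γ.IsTransitive) : LieAlgebra.IsSemisimple ℂ Γ.gMin := by
  -- For a solvable ideal this abelian term is zero only if the ideal is zero.
  have hab := LieAlgebra.abelian_derivedAbelianOfIdeal (LieAlgebra.radical ℂ Γ.gMin)
  have hbot := h.eq_bot_of_isLieAbelian
    (A := LieAlgebra.derivedAbelianOfIdeal (LieAlgebra.radical ℂ Γ.gMin))
    (fun a ha b hb => congrArg Subtype.val (hab.trivial ⟨a, ha⟩ ⟨b, hb⟩))
    (LieIdeal.map_mem_derivedAbelianOfIdeal (minScale_mem_radical two))
  rw [LieAlgebra.abelian_of_solvable_ideal_eq_bot_iff] at hbot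
  have : LieAlgebra.HasTrivialRadical ℂ Γ.gMin := ⟨hbot⟩
  infer_instance

end LocalLieAlgebra

theorem proposition3 {g₀ V : Type*}
    [LieRing g₀] [LieAlgebra ℂ g₀] [FiniteDimensional ℂ g₀]
    [AddCommGroup V] [Module ℂ V] [FiniteDimensional ℂ V]
    [LieRingModule g₀ V] [LieModule ℂ g₀ V]
    (B₀ : QuadraticLieForm g₀)
    (hred : LieAlgebra.HasCentralRadical ℂ g₀)
    (hcr : ComplementedLattice (LieSubmodule ℂ g₀ V))
    (htrans : (B₀.localLieAlgebra V).IsTransitive)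
    (hfin : FiniteDimensional ℂ (B₀.localLieAlgebra V).gMin) :
    LieAlgebra.IsSemisimple ℂ (B₀.localLieAlgebra V).gMin :=
  htrans.isSemisimple_gMin
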